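/- Let $X$ be a nonempty compact metric space, let $\mathcal{K}(X)$ be the set of nonempty compact subsets of $X$ with the Hausdorff metric, and equip $\mathcal{K}(X)\times(0,1)$ with the product topology. For $E\subseteq X$ and $r>0$ let $N(E,r)$ be the minimal number of open balls of radius $r$ in $X$ needed to cover $E$, and let $B(x,R)$ be the closed ball with centre $x$ and radius $R$. For $F\in\mathcal{K}(X)$ and $\theta\in(0,1)$ the lower spectrum is $$\dim_{\mathrm L}^\theta F=\sup\Big\{\alpha\in\mathbb{R}:\ (\exists C>0)(\exists \rho>0)(\forall\, 0<R\le\rho)(\forall x\in F)\ \ N\big(B(x,R)\cap F,R^{1/\theta}\big)\ge C\Big(\frac{R}{R^{1/\theta}}\Big)^{\alpha}\Big\}\in[0,\infty].$$ A function between topological spaces is of Baire class $0$ if it is continuous, and of Baire class $n+1$ if it is a pointwise limit of a sequence of functions of Baire class $n$. **Theorem.** For every nonempty compact metric space $X$, the function $\Delta_{\mathrm L}(F,\theta)=\dim_{\mathrm L}^\theta F$ on $\mathcal{K}(X)\times(0,1)$ is of Baire class $2$ and, in particular, Borel measurable, as a function with values in the extended real line; if all its values are finite, it is also of Baire class $2$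 as a function with values in $\mathbb{R}$. In general it is not of Baire class $1$: for $X=[0,1]$ all its values are finite, and it is not of Baire class $1$, neither as an extended-real-valued nor as a real-valued function. -/

import Mathlib

open Filter Topology Metric TopologicalSpace

noncomputable section

/-- Baire classes of functions between topological spaces: class `0` consists of the continuous
functions, and class `n + 1` of the pointwise limits of sequences of functions of class `n`. -/
def IsBaireClass {A B : Type*} [TopologicalSpace A] [TopologicalSpace B] :
    ℕ → (A → B) → Prop
  | 0, f => Continuous f
  | n + 1, f => ∃ g : ℕ → A → B, (∀ k, IsBaireClass n (g k)) ∧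
      ∀ a, Tendsto (fun k => g k a) atTop (𝓝 (f a))

/-- `coverNumber E r` is the minimal number of open balls of radius `r` of the ambient space `X`
that are needed to cover `E`. A finite cover exists for all `E` and `r > 0` when `X` is compact
(see `exists_cover_card_eq_coverNumber`). -/
def coverNumber {X : Type*} [MetricSpace X] (E : Set X) (r : ℝ) : ℕ :=
  sInf {n : ℕ | ∃ t : Finset X, t.card = n ∧ E ⊆ ⋃ c ∈ t, ball c r}

/-- In a compact space the minimum that defines the covering number is taken over a nonempty set,
hence attained. -/
theorem exists_cover_card_eq_coverNumber {X : Type*} [MetricSpace X] [CompactSpace X]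
    (E : Set X) {r : ℝ} (hr : 0 < r) :
    ∃ t : Finset X, t.card = coverNumber E r ∧ E ⊆ ⋃ c ∈ t, ball c r := by
  refine Nat.sInf_mem (s := {n : ℕ | ∃ t : Finset X, t.card = n ∧ E ⊆ ⋃ c ∈ t, ball c r}) ?_
  obtain ⟨t, ht, hcov⟩ :=
    totallyBounded_iff.1 (isCompact_univ (X := X)).totallyBounded r hr
  exact ⟨_, ht.toFinset, rfl, fun x _ => by simpa using hcov (Set.mem_univ x)⟩

/-- The exponents admissible in the definition of the lower spectrum: those real `α` for which
there are `C > 0` and `ρ > 0` such that, for all `0 < R ≤ ρ` and all `x ∈ F`, at least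
`C (R / R ^ (1 / θ)) ^ α` balls of radius `R ^ (1 / θ)` are needed to cover `B(x, R) ∩ F`. -/
def lowerSpectrumExponents {X : Type*} [MetricSpace X] (F : Set X) (θ : ℝ) : Set ℝ :=
  {α : ℝ | ∃ C : ℝ, 0 < C ∧ ∃ ρ : ℝ, 0 < ρ ∧ ∀ R : ℝ, 0 < R → R ≤ ρ → ∀ x ∈ F,
    C * (R / R ^ (1 / θ)) ^ α ≤ (coverNumber (closedBall x R ∩ F) (R ^ (1 / θ)) : ℝ)}

/-- The lower spectrum `dim_L^θ F` (for `0 < θ < 1`), the supremum of the admissible exponents.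
It is an extended real number, since it is `⊤` for some compact `F`. -/
def lowerSpectrum {X : Type*} [MetricSpace X] (F : Set X) (θ : ℝ) : EReal :=
  sSup ((fun α : ℝ => (α : EReal)) '' lowerSpectrumExponents F θ)

/-- The map `(F, θ) ↦ dim_L^θ F` on `𝒦(X) × (0, 1)`. Here `𝒦(X) = NonemptyCompacts X` carries
Mathlib's topology, which is that of the Hausdorff metric. -/
def lowerSpectrumMap (X : Type*) [MetricSpace X]
    (p : NonemptyCompacts X × Set.Ioo (0 : ℝ) 1) : EReal :=
  lowerSpectrum (p.1 : Set X) (p.2 : ℝ)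

end

/-! Class two: fix the constant `C = 1` and a largest scale `ρ`. A violation of the covering bound
at one `R` and one centre survives small perturbations of `(F, θ)`, because every nearby set has a
centre whose local covering number is no larger (`eventually_exists_coverNumber_le`). The bound is
thus a closed condition, and the largest exponent valid up to scale `1 / (n + 2)`, capped at `n`, is
bounded and upper semicontinuous, hence of class one. These functions converge to the lower
spectrum, since a slightly smaller exponent absorbs any `C` at small scales
(`exists_hasLocalCoverBound`).

Not class one: in `𝒦([0, 1])` the finite sets, with value at most `0`, and the closed thickenings,
with value at least `1`, are both dense. Baire category excludes this for a function of class one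
(`not_isBaireClass_one_of_dense`). -/

/-! ### Baire classes -/

/-- A bounded nonnegative upper semicontinuous function on a metric space is a pointwise limit of
continuous functions, namely of its Lipschitz sup-convolutions. -/
theorem UpperSemicontinuous.isBaireClass_one {A : Type*} [PseudoMetricSpace A] {g : A → ℝ}
    (hg : UpperSemicontinuous g) (h0 : ∀ a, 0 ≤ g a) {B : ℝ} (hB : ∀ a, g a ≤ B) :
    IsBaireClass 1 g := by
  have hbdd : ∀ (k : ℕ) (x : A), BddAbove (Set.range fun y => g y - k * dist x y) := by
    rintro k x
    refine ⟨B, ?_⟩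
    rintro _ ⟨y, rfl⟩
    have : 0 ≤ (k : ℝ) * dist x y := by positivity
    have := hB y
    linarith
  refine ⟨fun k x => ⨆ y, (g y - k * dist x y), fun k => ?_, fun a => ?_⟩
  · refine (LipschitzWith.of_le_add_mul (k : NNReal) fun x y => ?_).continuous
    have : Nonempty A := ⟨x⟩
    refine ciSup_le fun z => ?_
    have h1 := le_ciSup (hbdd k y) z
    have h2 : (k : ℝ) * dist y z ≤ k * (dist x y + dist x z) := by
      gcongr
      exact dist_triangle_left y z x
    push_cast
    linarith
  · have : Nonempty A := ⟨a⟩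
    have hle : ∀ k : ℕ, g a ≤ ⨆ y, (g y - k * dist a y) := fun k => by
      simpa using le_ciSup (hbdd k a) a
    rw [tendsto_order]
    refine ⟨fun c hc => Eventually.of_forall fun k => hc.trans_le (hle k), fun c hc => ?_⟩
    obtain ⟨c', hac', hc'c⟩ := exists_between hc
    obtain ⟨δ, hδ, hball⟩ := Metric.eventually_nhds_iff.1 (hg a c' hac')
    -- Beyond distance `δ` the penalty exceeds the bound `B`, so only points of the `δ`-ball matter.
    obtain ⟨n, hn⟩ := exists_nat_gt (B / δ)
    filter_upwards [eventually_ge_atTop n] with k hk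
    refine (ciSup_le fun y => ?_).trans_lt hc'c
    rcases lt_or_ge (dist y a) δ with hy | hy
    · have : 0 ≤ (k : ℝ) * dist a y := by positivity
      linarith [hball hy]
    · have h1 : B < n * δ := (div_lt_iff₀ hδ).1 hn
      have h2 : (n : ℝ) * δ ≤ k * dist a y := by
        rw [dist_comm a y]
        gcongr
      linarith [hB y, h0 a]

/-- Composing with a continuous map preserves Baire classes. -/
theorem IsBaireClass.continuous_comp {A B C : Type*} [TopologicalSpace A] [TopologicalSpace B]
    [TopologicalSpace C] {φ : B → C} (hφ : Continuous φ) :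
    ∀ {n : ℕ} {f : A → B}, IsBaireClass n f → IsBaireClass n fun a => φ (f a)
  | 0, _, hf => hφ.comp hf
  | _ + 1, _, ⟨g, hg, hlim⟩ => ⟨fun k a => φ (g k a), fun k => (hg k).continuous_comp hφ,
      fun a => (hφ.tendsto _).comp (hlim a)⟩

/-- Restricting along a continuous map preserves Baire classes. -/
theorem IsBaireClass.comp_continuous {A B C : Type*} [TopologicalSpace A] [TopologicalSpace B]
    [TopologicalSpace C] {φ : C → A} (hφ : Continuous φ) :
    ∀ {n : ℕ} {f : A → B}, IsBaireClass n f → IsBaireClass n fun c => f (φ c)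
  | 0, _, hf => Continuous.comp hf hφ
  | _ + 1, _, ⟨g, hg, hlim⟩ => ⟨fun k c => g k (φ c), fun k => (hg k).comp_continuous hφ,
      fun c => hlim (φ c)⟩

/-- Functions of any finite Baire class with values in a metrizable space are Borel measurable. -/
theorem IsBaireClass.measurable {A B : Type*} [TopologicalSpace A] [MeasurableSpace A]
    [BorelSpace A] [TopologicalSpace B] [PseudoMetrizableSpace B] [MeasurableSpace B]
    [BorelSpace B] : ∀ {n : ℕ} {f : A → B}, IsBaireClass n f → Measurable f
  | 0, _, hf => Continuous.measurable hf
  | _ + 1, _, ⟨_, hg, hlim⟩ =>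
      measurable_of_tendsto_metrizable (fun k => (hg k).measurable) (tendsto_pi_nhds.2 hlim)

/-- On a Baire space, a function of Baire class one cannot be separated by two values on dense
sets. -/
theorem not_isBaireClass_one_of_dense {A B : Type*} [TopologicalSpace A] [BaireSpace A]
    [Nonempty A] [TopologicalSpace B] [LinearOrder B] [OrderTopology B] {f : A → B} {c d : B}
    (hcd : c < d) (hlow : Dense {a | f a < c}) (hhigh : Dense {a | d < f a}) :
    ¬ IsBaireClass 1 f := by
  rintro ⟨g, hg, hlim⟩
  have hg : ∀ k, Continuous (g k) := hg
  have hG : ∀ n, IsOpen {a | ∃ k ≥ n, g k a < c} := fun n => by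
    simp only [Set.ofPred_exists, Set.ofPred_and]
    exact isOpen_iUnion fun k => isOpen_const.inter (isOpen_lt (hg k) continuous_const)
  have hH : ∀ n, IsOpen {a | ∃ k ≥ n, d < g k a} := fun n => by
    simp only [Set.ofPred_exists, Set.ofPred_and]
    exact isOpen_iUnion fun k => isOpen_const.inter (isOpen_lt continuous_const (hg k))
  have hGd : ∀ n, Dense {a | ∃ k ≥ n, g k a < c} := fun n => hlow.mono fun a ha =>
    ((eventually_ge_atTop n).and ((hlim a).eventually (gt_mem_nhds ha))).exists
  have hHd : ∀ n, Dense {a | ∃ k ≥ n, d < g k a} := fun n => hhigh.mono fun a ha =>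
    ((eventually_ge_atTop n).and ((hlim a).eventually (lt_mem_nhds ha))).exists
  -- On this dense set `g k a` is infinitely often below `c` and infinitely often above `d`.
  have hd : Dense (⋂ n, {a | ∃ k ≥ n, g k a < c} ∩ {a | ∃ k ≥ n, d < g k a}) :=
    dense_iInter_of_isOpen_nat (fun n => (hG n).inter (hH n))
      fun n => (hGd n).inter_of_isOpen_left (hHd n) (hG n)
  obtain ⟨a, ha⟩ := hd.nonempty
  rw [Set.mem_iInter] at ha
  have h1 : f a ≤ c := le_of_not_gt fun h => by
    obtain ⟨n, hn⟩ := eventually_atTop.1 ((hlim a).eventually (lt_mem_nhds h))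
    obtain ⟨k, hk, hkc⟩ := (ha n).1
    exact (hn k hk).not_gt hkc
  have h2 : d ≤ f a := le_of_not_gt fun h => by
    obtain ⟨n, hn⟩ := eventually_atTop.1 ((hlim a).eventually (gt_mem_nhds h))
    obtain ⟨k, hk, hkc⟩ := (ha n).2
    exact (hn k hk).not_gt hkc
  exact (hcd.trans_le h2).not_ge h1

/-! ### Semicontinuity of covering numbers -/

section CoverNumber

variable {X : Type*} [MetricSpace X]

theorem coverNumber_le_card {E : Set X} {r : ℝ} {t : Finset X} (h : E ⊆ ⋃ c ∈ t, ball c r) :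
    coverNumber E r ≤ t.card :=
  Nat.sInf_le ⟨t, rfl, h⟩

theorem one_le_coverNumber [CompactSpace X] {E : Set X} (hE : E.Nonempty) {r : ℝ} (hr : 0 < r) :
    1 ≤ coverNumber E r := by
  obtain ⟨t, ht, hcov⟩ := exists_cover_card_eq_coverNumber E hr
  obtain ⟨x, hx⟩ := hE
  obtain ⟨c, hc, -⟩ := Set.mem_iUnion₂.1 (hcov hx)
  rw [← ht, Nat.one_le_iff_ne_zero]
  exact Finset.card_ne_zero_of_mem hc

/-- The radius of a finite cover of a compact set by open balls can be decreased a little. -/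
theorem IsCompact.exists_lt_radius_cover {K : Set X} (hK : IsCompact K) {t : Finset X} {r : ℝ}
    (h : K ⊆ ⋃ c ∈ t, ball c r) : ∃ r' < r, K ⊆ ⋃ c ∈ t, ball c r' := by
  have hmono : Monotone fun s : Set.Iio r => ⋃ c ∈ t, ball c (s : ℝ) := fun s s' hs =>
    Set.iUnion₂_mono fun c _ => ball_subset_ball hs
  have : Nonempty (Set.Iio r) := ⟨⟨r - 1, by simp⟩⟩
  have hsub : K ⊆ ⋃ s : Set.Iio r, ⋃ c ∈ t, ball c (s : ℝ) := fun x hx => by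
    obtain ⟨c, hc, hxc⟩ := Set.mem_iUnion₂.1 (h hx)
    obtain ⟨s, hs1, hs2⟩ := exists_between (mem_ball.1 hxc)
    exact Set.mem_iUnion.2 ⟨⟨s, hs2⟩, Set.mem_iUnion₂.2 ⟨c, hc, hs1⟩⟩
  obtain ⟨s, hs⟩ := hK.elim_directed_cover (fun s : Set.Iio r => ⋃ c ∈ t, ball c (s : ℝ))
    (fun s => isOpen_biUnion fun c _ => isOpen_ball) hsub hmono.directed_le
  exact ⟨s, s.2, hs⟩

/-- Upper semicontinuity of the local covering numbers in the set, the centre and the exponent. -/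
theorem eventually_exists_coverNumber_le [CompactSpace X] {R : ℝ} (hR : 0 < R)
    (p₀ : NonemptyCompacts X × Set.Ioo (0 : ℝ) 1) {x₀ : X} (hx₀ : x₀ ∈ p₀.1) :
    ∀ᶠ p : NonemptyCompacts X × Set.Ioo (0 : ℝ) 1 in 𝓝 p₀, ∃ x ∈ p.1,
      coverNumber (closedBall x R ∩ p.1) (R ^ (1 / (p.2 : ℝ))) ≤
        coverNumber (closedBall x₀ R ∩ p₀.1) (R ^ (1 / (p₀.2 : ℝ))) := by
  obtain ⟨F₀, θ₀⟩ := p₀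
  obtain ⟨t, ht, hcov⟩ := exists_cover_card_eq_coverNumber (closedBall x₀ R ∩ F₀)
    (Real.rpow_pos_of_pos hR (1 / (θ₀ : ℝ)))
  obtain ⟨r', hr', hcov'⟩ :=
    (F₀.isCompact.inter_left isClosed_closedBall).exists_lt_radius_cover hcov
  set U := ⋃ c ∈ t, ball c r' with hU
  have hUo : IsOpen U := isOpen_biUnion fun c _ => isOpen_ball
  -- The part of `F₀` outside `U` is compact and misses the closed `R`-ball, so it stays beyond some
  -- `R' > R`. This gap leaves room to move both the set and the centre.
  obtain ⟨R', hRR', hR'⟩ := (F₀.isCompact.diff hUo).exists_forall_le' (f := fun y => dist y x₀)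
    (a := R) (by fun_prop) (fun y hy => lt_of_not_ge fun h => hy.2 (hcov' ⟨h, hy.1⟩))
  obtain ⟨R₁, hRR₁, hR₁⟩ := exists_between hRR'
  have hWo : IsOpen (U ∪ {y | R₁ < dist y x₀}) :=
    hUo.union (isOpen_lt continuous_const (by fun_prop))
  have hθ : ∀ᶠ θ : Set.Ioo (0 : ℝ) 1 in 𝓝 θ₀, r' < R ^ (1 / (θ : ℝ)) := by
    have hc : ContinuousAt (fun θ : Set.Ioo (0 : ℝ) 1 => R ^ (1 / (θ : ℝ))) θ₀ :=
      ContinuousAt.rpow continuousAt_const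
        (continuousAt_const.div continuousAt_subtype_val θ₀.2.1.ne') (Or.inl hR.ne')
    exact hc.eventually (lt_mem_nhds hr')
  have hW : ∀ᶠ F : NonemptyCompacts X in 𝓝 F₀, (F : Set X) ⊆ U ∪ {y | R₁ < dist y x₀} :=
    (NonemptyCompacts.isOpen_subsets_of_isOpen hWo).mem_nhds fun y hy => by
      by_cases hyU : y ∈ U
      · exact Or.inl hyU
      · exact Or.inr (hR₁.trans_le (hR' y ⟨hy, hyU⟩))
  have hx : ∀ᶠ F : NonemptyCompacts X in 𝓝 F₀, ((F : Set X) ∩ ball x₀ (R₁ - R)).Nonempty :=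
    (NonemptyCompacts.isOpen_inter_nonempty_of_isOpen isOpen_ball).mem_nhds
      ⟨x₀, hx₀, mem_ball_self (sub_pos.2 hRR₁)⟩
  filter_upwards [(hW.and hx).prod_nhds hθ] with p hp
  obtain ⟨⟨hpW, x, hxF, hxb⟩, hpθ⟩ := hp
  refine ⟨x, hxF, ?_⟩
  rw [← ht]
  refine coverNumber_le_card fun y hy => ?_
  have hyU : y ∈ U := (hpW hy.2).resolve_right fun h => by
    have h1 := mem_closedBall.1 hy.1
    have h2 := mem_ball.1 hxb
    have h3 := dist_triangle y x x₀
    have h4 : R₁ < dist y x₀ := h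
    linarith
  obtain ⟨c, hc, hyc⟩ := Set.mem_iUnion₂.1 hyU
  exact Set.mem_iUnion₂.2 ⟨c, hc, ball_subset_ball hpθ.le hyc⟩

end CoverNumber

theorem one_le_div_rpow {R θ : ℝ} (hR : 0 < R) (hR1 : R ≤ 1) (hθ : θ ∈ Set.Ioo (0 : ℝ) 1) :
    1 ≤ R / R ^ (1 / θ) := by
  rw [one_le_div (Real.rpow_pos_of_pos hR _)]
  have h : 1 ≤ 1 / θ := (one_le_div hθ.1).2 hθ.2.le
  simpa using Real.rpow_le_rpow_of_exponent_ge hR hR1 h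

theorem tendsto_div_rpow_atTop {θ : ℝ} (hθ : θ ∈ Set.Ioo (0 : ℝ) 1) :
    Tendsto (fun R : ℝ => R / R ^ (1 / θ)) (𝓝[>] 0) atTop := by
  have h : 1 - 1 / θ < 0 := sub_neg.2 ((one_lt_div hθ.1).2 hθ.2)
  refine (tendsto_rpow_neg_nhdsGT_zero h).congr' ?_
  filter_upwards [self_mem_nhdsWithin] with R hR
  rw [Real.rpow_sub hR, Real.rpow_one]

/-! ### Admissible exponents and class two -/

section LowerSpectrum

variable {X : Type*} [MetricSpace X]

/-- The lower bound on covering numbers with exponent `α` at all scales up to `ρ`, with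
multiplicative constant one. -/
def HasLocalCoverBound (F : Set X) (θ ρ α : ℝ) : Prop :=
  ∀ R : ℝ, 0 < R → R ≤ ρ → ∀ x ∈ F,
    (R / R ^ (1 / θ)) ^ α ≤ (coverNumber (closedBall x R ∩ F) (R ^ (1 / θ)) : ℝ)

theorem HasLocalCoverBound.anti {F : Set X} {θ ρ ρ' α α' : ℝ} (hθ : θ ∈ Set.Ioo (0 : ℝ) 1)
    (hρ : ρ ≤ 1) (h : HasLocalCoverBound F θ ρ α) (hρ' : ρ' ≤ ρ) (hα : α' ≤ α) :
    HasLocalCoverBound F θ ρ' α' := fun R hR hRρ x hx =>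
  (Real.rpow_le_rpow_of_exponent_le (one_le_div_rpow hR (by linarith) hθ) hα).trans
    (h R hR (hRρ.trans hρ') x hx)

theorem HasLocalCoverBound.mem_lowerSpectrumExponents {F : Set X} {θ ρ α : ℝ} (hρ : 0 < ρ)
    (h : HasLocalCoverBound F θ ρ α) : α ∈ lowerSpectrumExponents F θ :=
  ⟨1, one_pos, ρ, hρ, fun R hR hRρ x hx => by simpa using h R hR hRρ x hx⟩

theorem hasLocalCoverBound_zero [CompactSpace X] (F : Set X) (θ ρ : ℝ) :
    HasLocalCoverBound F θ ρ 0 := fun R hR _ x hx => by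
  rw [Real.rpow_zero]
  exact_mod_cast one_le_coverNumber (E := closedBall x R ∩ F)
    ⟨x, mem_closedBall_self hR.le, hx⟩ (Real.rpow_pos_of_pos hR _)

/-- Lowering the exponent absorbs the multiplicative constant at small scales. -/
theorem exists_hasLocalCoverBound {F : Set X} {θ α β : ℝ} (hθ : θ ∈ Set.Ioo (0 : ℝ) 1)
    (hα : α ∈ lowerSpectrumExponents F θ) (hβ : β < α) :
    ∃ ρ > 0, HasLocalCoverBound F θ ρ β := by
  obtain ⟨C, hC, ρ, hρ, h⟩ := hα
  have hlim : Tendsto (fun R : ℝ => (R / R ^ (1 / θ)) ^ (α - β)) (𝓝[>] 0) atTop :=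
    (tendsto_rpow_atTop (sub_pos.2 hβ)).comp (tendsto_div_rpow_atTop hθ)
  obtain ⟨ρ', hρ', hlarge⟩ := mem_nhdsGT_iff_exists_Ioc_subset.1
    (hlim.eventually_ge_atTop C⁻¹)
  refine ⟨min ρ ρ', lt_min hρ hρ', fun R hR hRρ x hx => ?_⟩
  refine le_trans ?_ (h R hR (hRρ.trans (min_le_left _ _)) x hx)
  have hq : 0 < R / R ^ (1 / θ) := div_pos hR (Real.rpow_pos_of_pos hR _)
  have h1 : C⁻¹ ≤ (R / R ^ (1 / θ)) ^ (α - β) := hlarge ⟨hR, hRρ.trans (min_le_right _ _)⟩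
  have h2 : 1 ≤ C * (R / R ^ (1 / θ)) ^ (α - β) := by
    rwa [inv_le_iff_one_le_mul₀' hC] at h1
  calc (R / R ^ (1 / θ)) ^ β
      ≤ C * (R / R ^ (1 / θ)) ^ (α - β) * (R / R ^ (1 / θ)) ^ β :=
        le_mul_of_one_le_left (Real.rpow_nonneg hq.le _) h2
    _ = C * (R / R ^ (1 / θ)) ^ α := by
        rw [mul_assoc, ← Real.rpow_add hq, sub_add_cancel]

/-- A violation is a strict inequality at one `R` and one centre. Its left side is continuous in
`θ`, and its right side does not increase for a suitable centre of a nearby set. -/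
theorem isOpen_not_hasLocalCoverBound [CompactSpace X] (ρ α : ℝ) :
    IsOpen {p : NonemptyCompacts X × Set.Ioo (0 : ℝ) 1 |
      ¬ HasLocalCoverBound (p.1 : Set X) (p.2 : ℝ) ρ α} := by
  rw [isOpen_iff_eventually]
  intro p₀ hp₀
  simp only [HasLocalCoverBound, Set.mem_ofPred_eq, not_forall, not_le] at hp₀
  obtain ⟨R, hR, hRρ, x₀, hx₀, hlt⟩ := hp₀
  have hc : ContinuousAt (fun p : NonemptyCompacts X × Set.Ioo (0 : ℝ) 1 =>
      (R / R ^ (1 / (p.2 : ℝ))) ^ α) p₀ := by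
    have h1 : ContinuousAt (fun p : NonemptyCompacts X × Set.Ioo (0 : ℝ) 1 =>
        R ^ (1 / (p.2 : ℝ))) p₀ :=
      ContinuousAt.rpow continuousAt_const
        (continuousAt_const.div (by fun_prop) p₀.2.2.1.ne') (Or.inl hR.ne')
    have h2 : 0 < R ^ (1 / (p₀.2 : ℝ)) := Real.rpow_pos_of_pos hR _
    exact (continuousAt_const.div h1 h2.ne').rpow_const (Or.inl (div_pos hR h2).ne')
  filter_upwards [eventually_exists_coverNumber_le hR p₀ hx₀, hc.eventually (lt_mem_nhds hlt)]
    with p ⟨x, hx, hle⟩ hp hbound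
  exact ((hbound R hR hRρ x hx).trans (Nat.cast_le.2 hle)).not_gt hp

/-- The largest exponent in `[0, n]` for which the local covering bound holds at all scales up to
`1 / (n + 2)`. -/
noncomputable def lowerSpectrumApprox (X : Type*) [MetricSpace X] (n : ℕ)
    (p : NonemptyCompacts X × Set.Ioo (0 : ℝ) 1) : ℝ :=
  sSup {α : ℝ | α ∈ Set.Icc (0 : ℝ) n ∧
    HasLocalCoverBound (p.1 : Set X) (p.2 : ℝ) (1 / ((n : ℝ) + 2)) α}

theorem one_div_natCast_add_two_le_one (n : ℕ) : 1 / ((n : ℝ) + 2) ≤ 1 := by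
  rw [div_le_one (by positivity)]
  linarith [(Nat.cast_nonneg n : (0 : ℝ) ≤ n)]

theorem le_lowerSpectrumApprox {n : ℕ} {p : NonemptyCompacts X × Set.Ioo (0 : ℝ) 1} {α : ℝ}
    (hα : α ∈ Set.Icc (0 : ℝ) n)
    (h : HasLocalCoverBound (p.1 : Set X) (p.2 : ℝ) (1 / ((n : ℝ) + 2)) α) :
    α ≤ lowerSpectrumApprox X n p :=
  le_csSup ⟨n, fun _ hβ => hβ.1.2⟩ ⟨hα, h⟩

/-- An upper bound on the covering numbers around one point of `F` at each small scale bounds the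
lower spectrum. -/
theorem lowerSpectrum_le_of_forall_exists {F : Set X} {θ A a : ℝ} (hθ : θ ∈ Set.Ioo (0 : ℝ) 1)
    (h : ∀ R : ℝ, 0 < R → R ≤ 1 → ∃ x ∈ F,
      (coverNumber (closedBall x R ∩ F) (R ^ (1 / θ)) : ℝ) ≤ A * (R / R ^ (1 / θ)) ^ a) :
    lowerSpectrum F θ ≤ a := by
  refine sSup_le ?_
  rintro _ ⟨α, hα, rfl⟩
  refine EReal.coe_le_coe_iff.2 (le_of_not_gt fun haα => ?_)
  -- At the intermediate exponent the lower bound has constant one, and the unbounded factor with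
  -- exponent `β - a` then beats `A`.
  obtain ⟨β, haβ, hβα⟩ := exists_between haα
  obtain ⟨ρ, hρ, hb⟩ := exists_hasLocalCoverBound hθ hα hβα
  have hlim : Tendsto (fun R : ℝ => (R / R ^ (1 / θ)) ^ (β - a)) (𝓝[>] 0) atTop :=
    (tendsto_rpow_atTop (sub_pos.2 haβ)).comp (tendsto_div_rpow_atTop hθ)
  obtain ⟨R, ⟨hlarge, hR0⟩, hR⟩ := ((hlim.eventually_gt_atTop A).and
    self_mem_nhdsWithin |>.and (Ioc_mem_nhdsGT (lt_min hρ one_pos))).exists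
  have hR0 : 0 < R := hR0
  obtain ⟨x, hx, hcov⟩ := h R hR0 (hR.2.trans (min_le_right _ _))
  have hle := (hb R hR0 (hR.2.trans (min_le_left _ _)) x hx).trans hcov
  have hq : 0 < R / R ^ (1 / θ) := div_pos hR0 (Real.rpow_pos_of_pos hR0 _)
  rw [Real.rpow_sub hq, lt_div_iff₀ (Real.rpow_pos_of_pos hq _)] at hlarge
  exact hle.not_gt hlarge

theorem lowerSpectrum_le_zero_of_finite {F : Set X} (hF : F.Finite) (hne : F.Nonempty) {θ : ℝ}
    (hθ : θ ∈ Set.Ioo (0 : ℝ) 1) : lowerSpectrum F θ ≤ 0 := by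
  refine lowerSpectrum_le_of_forall_exists (A := hF.toFinset.card) (a := 0) hθ fun R hR _ => ?_
  obtain ⟨x, hx⟩ := hne
  refine ⟨x, hx, ?_⟩
  rw [Real.rpow_zero, mul_one]
  refine Nat.cast_le.2 (coverNumber_le_card fun y hy => Set.mem_iUnion₂.2 ⟨y, ?_, ?_⟩)
  · simpa using hy.2
  · exact mem_ball_self (Real.rpow_pos_of_pos hR _)

variable [CompactSpace X]

theorem lowerSpectrumApprox_nonneg (n : ℕ) (p : NonemptyCompacts X × Set.Ioo (0 : ℝ) 1) :
    0 ≤ lowerSpectrumApprox X n p :=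
  le_lowerSpectrumApprox ⟨le_rfl, Nat.cast_nonneg n⟩ (hasLocalCoverBound_zero _ _ _)

theorem exists_of_lt_lowerSpectrumApprox {n : ℕ} {p : NonemptyCompacts X × Set.Ioo (0 : ℝ) 1}
    {β : ℝ} (h : β < lowerSpectrumApprox X n p) :
    ∃ α > β, HasLocalCoverBound (p.1 : Set X) (p.2 : ℝ) (1 / ((n : ℝ) + 2)) α := by
  have hne : {α : ℝ | α ∈ Set.Icc (0 : ℝ) n ∧
      HasLocalCoverBound (p.1 : Set X) (p.2 : ℝ) (1 / ((n : ℝ) + 2)) α}.Nonempty :=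
    ⟨0, ⟨le_rfl, Nat.cast_nonneg n⟩, hasLocalCoverBound_zero _ _ _⟩
  obtain ⟨α, hα, hβ⟩ := exists_lt_of_lt_csSup hne h
  exact ⟨α, hβ, hα.2⟩

theorem lowerSpectrumApprox_le (n : ℕ) (p : NonemptyCompacts X × Set.Ioo (0 : ℝ) 1) :
    lowerSpectrumApprox X n p ≤ n :=
  csSup_le ⟨0, ⟨le_rfl, Nat.cast_nonneg n⟩, hasLocalCoverBound_zero _ _ _⟩ fun _ hα => hα.1.2

/-- A value below `c ≤ n` means that the bound fails at some `c' < c`. This failure is open and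
passes to all larger exponents. -/
theorem upperSemicontinuous_lowerSpectrumApprox (n : ℕ) :
    UpperSemicontinuous (lowerSpectrumApprox X n) := by
  intro p₀ c hc
  rcases lt_or_ge (n : ℝ) c with hn | hn
  · exact Eventually.of_forall fun p => (lowerSpectrumApprox_le n p).trans_lt hn
  obtain ⟨c', hc', hc'c⟩ := exists_between hc
  have hfail : ¬ HasLocalCoverBound (p₀.1 : Set X) (p₀.2 : ℝ) (1 / ((n : ℝ) + 2)) c' := fun h =>
    (le_lowerSpectrumApprox ⟨(lowerSpectrumApprox_nonneg n p₀).trans hc'.le,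
      hc'c.le.trans hn⟩ h).not_gt hc'
  filter_upwards [(isOpen_not_hasLocalCoverBound _ _).mem_nhds hfail] with p hp
  refine (le_of_not_gt fun h => hp ?_).trans_lt hc'c
  obtain ⟨α, hα, hb⟩ := exists_of_lt_lowerSpectrumApprox h
  exact hb.anti p.2.2 (one_div_natCast_add_two_le_one n) le_rfl hα.le

theorem isBaireClass_one_lowerSpectrumApprox (n : ℕ) :
    IsBaireClass 1 (lowerSpectrumApprox X n) :=
  (upperSemicontinuous_lowerSpectrumApprox n).isBaireClass_one (lowerSpectrumApprox_nonneg n)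
    (lowerSpectrumApprox_le n)

theorem lowerSpectrumApprox_le_lowerSpectrumMap (n : ℕ)
    (p : NonemptyCompacts X × Set.Ioo (0 : ℝ) 1) :
    (lowerSpectrumApprox X n p : EReal) ≤ lowerSpectrumMap X p := by
  refine EReal.le_of_forall_lt_iff_le.1 fun c hc => ?_
  by_contra! hlt
  obtain ⟨α, hα, hb⟩ := exists_of_lt_lowerSpectrumApprox (EReal.coe_lt_coe_iff.1 hlt)
  have h1 : (α : EReal) ≤ lowerSpectrumMap X p :=
    le_sSup ⟨α, hb.mem_lowerSpectrumExponents (by positivity), rfl⟩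
  exact (h1.trans_lt hc).not_gt (EReal.coe_lt_coe_iff.2 hα)

theorem tendsto_lowerSpectrumApprox (p : NonemptyCompacts X × Set.Ioo (0 : ℝ) 1) :
    Tendsto (fun n => (lowerSpectrumApprox X n p : EReal)) atTop (𝓝 (lowerSpectrumMap X p)) := by
  rw [tendsto_order]
  refine ⟨fun c hc => ?_, fun c hc => Eventually.of_forall fun n =>
    (lowerSpectrumApprox_le_lowerSpectrumMap n p).trans_lt hc⟩
  obtain ⟨_, ⟨α, hα, rfl⟩, hcα⟩ := lt_sSup_iff.1 hc
  obtain ⟨β, hcβ, hβα⟩ := EReal.lt_iff_exists_real_btwn.1 hcα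
  -- The approximants only see exponents in `[0, n]`, so negative `β` is separate.
  rcases lt_or_ge β 0 with hβ | hβ
  · refine Eventually.of_forall fun n => hcβ.trans (EReal.coe_lt_coe_iff.2 ?_)
    exact hβ.trans_le (lowerSpectrumApprox_nonneg n p)
  obtain ⟨ρ, hρ, hb⟩ := exists_hasLocalCoverBound p.2.2 hα (EReal.coe_lt_coe_iff.1 hβα)
  have hsmall : Tendsto (fun n : ℕ => 1 / ((n : ℝ) + 2)) atTop (𝓝 0) :=
    tendsto_const_nhds.div_atTop (tendsto_atTop_add_const_right _ _ tendsto_natCast_atTop_atTop)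
  filter_upwards [hsmall.eventually (gt_mem_nhds hρ),
    tendsto_natCast_atTop_atTop.eventually (eventually_ge_atTop β)] with n hn hnβ
  refine hcβ.trans_le (EReal.coe_le_coe_iff.2 (le_lowerSpectrumApprox ⟨hβ, hnβ⟩ ?_))
  exact fun R hR hRn x hx => hb R hR (hRn.trans hn.le) x hx

theorem lowerSpectrumMap_nonneg (p : NonemptyCompacts X × Set.Ioo (0 : ℝ) 1) :
    0 ≤ lowerSpectrumMap X p :=
  le_trans (EReal.coe_nonneg.2 (lowerSpectrumApprox_nonneg 0 p))
    (lowerSpectrumApprox_le_lowerSpectrumMap 0 p)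

theorem isBaireClass_two_lowerSpectrumMap : IsBaireClass 2 (lowerSpectrumMap X) :=
  ⟨fun n p => (lowerSpectrumApprox X n p : EReal),
    fun n => (isBaireClass_one_lowerSpectrumApprox n).continuous_comp continuous_coe_real_ereal,
    tendsto_lowerSpectrumApprox⟩

theorem isBaireClass_two_toReal_lowerSpectrumMap (h : ∀ p, lowerSpectrumMap X p ≠ ⊤) :
    IsBaireClass 2 fun p => (lowerSpectrumMap X p).toReal :=
  ⟨lowerSpectrumApprox X, isBaireClass_one_lowerSpectrumApprox, fun p => by
    have hbot : lowerSpectrumMap X p ≠ ⊥ :=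
      (EReal.bot_lt_zero.trans_le (lowerSpectrumMap_nonneg p)).ne'
    exact (EReal.tendsto_toReal (h p) hbot).comp (tendsto_lowerSpectrumApprox p)⟩

end LowerSpectrum

/-! ### The unit interval: finiteness and failure of class one -/

section UnitInterval

theorem coverNumber_unitInterval_le (E : Set unitInterval) {r : ℝ} (hr : 0 < r) :
    (coverNumber E r : ℝ) ≤ 1 / r + 2 := by
  -- The `+ 1` makes the grid spacing `1 / m` strictly less than `r`, as open balls require.
  set m := ⌊1 / r⌋₊ + 1 with hm
  have hm0 : (0 : ℝ) < m := by positivity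
  have hmr : 1 / r < m := by
    rw [hm]
    exact_mod_cast Nat.lt_floor_add_one (1 / r)
  let t : Finset unitInterval := (Finset.range (m + 1)).image fun i : ℕ =>
    Set.projIcc (0 : ℝ) 1 zero_le_one ((i : ℝ) / m)
  have hcov : E ⊆ ⋃ c ∈ t, ball c r := fun x _ => by
    have hx0 : 0 ≤ (x : ℝ) * m := mul_nonneg x.2.1 hm0.le
    have hfl : ((⌊(x : ℝ) * m⌋₊ : ℕ) : ℝ) ≤ x * m := Nat.floor_le hx0
    have hlt := Nat.lt_floor_add_one ((x : ℝ) * m)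
    have hxm : (x : ℝ) * m ≤ m := mul_le_of_le_one_left hm0.le x.2.2
    have hi : ⌊(x : ℝ) * m⌋₊ < m + 1 := by
      have : ((⌊(x : ℝ) * m⌋₊ : ℕ) : ℝ) < m + 1 := by linarith
      exact_mod_cast this
    refine Set.mem_iUnion₂.2 ⟨_, Finset.mem_image_of_mem _ (Finset.mem_range.2 hi), ?_⟩
    rw [mem_ball, Subtype.dist_eq, Set.projIcc_of_mem zero_le_one
      ⟨div_nonneg (Nat.cast_nonneg _) hm0.le, (div_le_one hm0).2 (hfl.trans hxm)⟩,
      Real.dist_eq, abs_of_nonneg (sub_nonneg.2 ((div_le_iff₀ hm0).2 hfl))]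
    have h1 : (x : ℝ) < (⌊(x : ℝ) * m⌋₊ : ℝ) / m + 1 / m := by
      rw [← add_div, lt_div_iff₀ hm0]
      exact hlt
    have h2 : 1 / (m : ℝ) < r := (one_div_lt hr hm0).1 hmr
    linarith
  have h1 : coverNumber E r ≤ m + 1 :=
    (coverNumber_le_card hcov).trans (Finset.card_image_le.trans (Finset.card_range _).le)
  have h2 : ((⌊1 / r⌋₊ : ℕ) : ℝ) ≤ 1 / r := Nat.floor_le (by positivity)
  calc (coverNumber E r : ℝ) ≤ ((m + 1 : ℕ) : ℝ) := Nat.cast_le.2 h1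
    _ = ((⌊1 / r⌋₊ : ℕ) : ℝ) + 2 := by rw [hm]; push_cast; ring
    _ ≤ 1 / r + 2 := by linarith

/-- The exponent `1 / (1 - θ)` turns the ratio of scales into `1 / r` with `r = R ^ (1 / θ)`, and `3
/ r` balls of radius `r` cover all of `[0, 1]`. -/
theorem lowerSpectrumMap_unitInterval_le (p : NonemptyCompacts unitInterval × Set.Ioo (0 : ℝ) 1) :
    lowerSpectrumMap unitInterval p ≤ ((1 / (1 - (p.2 : ℝ)) : ℝ) : EReal) := by
  obtain ⟨F, θ, hθ⟩ := p
  refine lowerSpectrum_le_of_forall_exists (A := 3) hθ fun R hR hR1 => ?_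
  obtain ⟨x, hx⟩ := F.nonempty
  refine ⟨x, hx, ?_⟩
  have hr : 0 < R ^ (1 / θ) := Real.rpow_pos_of_pos hR _
  have hr1 : R ^ (1 / θ) ≤ 1 :=
    Real.rpow_le_one hR.le hR1 (one_div_nonneg.2 hθ.1.le)
  have h1 : 1 ≤ 1 / R ^ (1 / θ) := (one_le_div hr).2 hr1
  have hθ1 : 1 - θ ≠ 0 := (sub_pos.2 hθ.2).ne'
  have h2 : (R / R ^ (1 / θ)) ^ (1 / (1 - θ)) = 1 / R ^ (1 / θ) := by
    have h3 : R / R ^ (1 / θ) = R ^ (1 - 1 / θ) := by rw [Real.rpow_sub hR, Real.rpow_one]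
    have h4 : (1 - 1 / θ) * (1 / (1 - θ)) = -(1 / θ) := by
      have := hθ.1.ne'
      field_simp
      ring
    rw [h3, ← Real.rpow_mul hR.le, h4, Real.rpow_neg hR.le, one_div (R ^ (1 / θ))]
  rw [h2]
  linarith [coverNumber_unitInterval_le (closedBall x R ∩ F) hr]

/-- Compare Lebesgue measures: each ball has length `2 * r`. -/
theorem div_le_coverNumber_of_Icc_subset {E : Set unitInterval} {a L r : ℝ}
    (hr : 0 < r) (h : Set.Icc a (a + L) ⊆ (Subtype.val '' E : Set ℝ)) :
    L / (2 * r) ≤ coverNumber E r := by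
  obtain ⟨t, ht, hcov⟩ := exists_cover_card_eq_coverNumber E hr
  have hsub : Set.Icc a (a + L) ⊆ ⋃ c ∈ t, ball (c : ℝ) r := fun y hy => by
    obtain ⟨x, hx, rfl⟩ := h hy
    exact Set.mem_iUnion₂.2 (by simpa [Subtype.dist_eq] using Set.mem_iUnion₂.1 (hcov hx))
  have hvol : ENNReal.ofReal L ≤ ENNReal.ofReal (t.card * (2 * r)) :=
    calc ENNReal.ofReal L = MeasureTheory.volume (Set.Icc a (a + L)) := by simp
      _ ≤ MeasureTheory.volume (⋃ c ∈ t, ball (c : ℝ) r) := MeasureTheory.measure_mono hsub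
      _ ≤ ∑ c ∈ t, MeasureTheory.volume (ball (c : ℝ) r) :=
        MeasureTheory.measure_biUnion_finset_le _ _
      _ = ENNReal.ofReal (t.card * (2 * r)) := by
        simp [ENNReal.ofReal_mul]
  rw [div_le_iff₀ (by positivity), ← ht]
  exact (ENNReal.ofReal_le_ofReal_iff (by positivity)).1 hvol

theorem one_le_lowerSpectrum_cthickening {E : Set unitInterval} (hE : IsCompact E) {δ θ : ℝ}
    (hδ : 0 < δ) (hδ1 : δ ≤ 1) : 1 ≤ lowerSpectrum (cthickening δ E) θ := by
  refine le_sSup ⟨1, ⟨1 / 2, by norm_num, δ / 2, by positivity, fun R hR hRδ x hx => ?_⟩, rfl⟩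
  have hr : 0 < R ^ (1 / θ) := Real.rpow_pos_of_pos hR _
  rw [hE.cthickening_eq_biUnion_closedBall hδ.le] at hx
  obtain ⟨e, he, hxe⟩ := Set.mem_iUnion₂.1 hx
  rw [mem_closedBall, Subtype.dist_eq, Real.dist_eq, abs_le] at hxe
  -- It suffices to find an interval of length `R` with `x` as an endpoint inside the thickening. It
  -- points towards `e` unless it would leave `[0, 1]`; then `x` is within `R ≤ δ / 2` of the
  -- boundary and the opposite direction fits.
  have key : ∀ a : ℝ, 0 ≤ a → a + R ≤ 1 → (e : ℝ) - δ ≤ a → a + R ≤ e + δ → x - R ≤ a → a ≤ x →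
      1 / 2 * (R / R ^ (1 / θ)) ^ (1 : ℝ) ≤
        (coverNumber (closedBall x R ∩ cthickening δ E) (R ^ (1 / θ)) : ℝ) := by
    intro a ha0 ha1 hae1 hae2 hax1 hax2
    have h := div_le_coverNumber_of_Icc_subset (E := closedBall x R ∩ cthickening δ E)
      (a := a) (L := R) hr fun y hy => by
        refine ⟨⟨y, by linarith [hy.1], by linarith [hy.2]⟩, ⟨?_, ?_⟩, rfl⟩
        · rw [mem_closedBall, Subtype.dist_eq, Real.dist_eq, abs_le]
          constructor <;> dsimp only <;> linarith [hy.1, hy.2]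
        · refine closedBall_subset_cthickening he δ ?_
          rw [mem_closedBall, Subtype.dist_eq, Real.dist_eq, abs_le]
          constructor <;> dsimp only <;> linarith [hy.1, hy.2]
    refine le_of_eq_of_le ?_ h
    rw [Real.rpow_one]
    field_simp
  have hx0 := x.2.1
  have hx1 := x.2.2
  have he0 := e.2.1
  have he1 := e.2.2
  rcases le_total (e : ℝ) x with hex | hex
  · rcases le_total R (x : ℝ) with h | h
    · apply key (x - R) <;> linarith
    · apply key x <;> linarith
  · rcases le_total ((x : ℝ) + R) 1 with h | h
    · apply key x <;> linarith
    · apply key (x - R) <;> linarith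

theorem dense_one_le_lowerSpectrum (θ : ℝ) :
    Dense {F : NonemptyCompacts unitInterval | 1 ≤ lowerSpectrum (F : Set unitInterval) θ} := by
  rw [Metric.dense_iff]
  intro E ε hε
  set δ := min (ε / 2) 1 with hδdef
  have hδ : 0 < δ := lt_min (half_pos hε) one_pos
  let F : NonemptyCompacts unitInterval :=
    ⟨⟨cthickening δ (E : Set unitInterval), isClosed_cthickening.isCompact⟩,
      E.nonempty.mono (self_subset_cthickening _)⟩
  refine ⟨F, ?_, one_le_lowerSpectrum_cthickening E.isCompact hδ (min_le_right _ _)⟩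
  rw [mem_ball, NonemptyCompacts.dist_eq]
  refine lt_of_le_of_lt (hausdorffDist_le_of_mem_dist hδ.le (fun x hx => ?_) fun x hx =>
    ⟨x, self_subset_cthickening _ hx, by simpa using hδ.le⟩)
    ((min_le_left _ _).trans_lt (half_lt_self hε))
  have hx : x ∈ cthickening δ (E : Set unitInterval) := hx
  rw [E.isCompact.cthickening_eq_biUnion_closedBall hδ.le] at hx
  obtain ⟨e, he, hxe⟩ := Set.mem_iUnion₂.1 hx
  exact ⟨e, he, hxe⟩

theorem lowerSpectrumMap_unitInterval_ne_top
    (p : NonemptyCompacts unitInterval × Set.Ioo (0 : ℝ) 1) :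
    lowerSpectrumMap unitInterval p ≠ ⊤ :=
  ((lowerSpectrumMap_unitInterval_le p).trans_lt (EReal.coe_lt_top _)).ne

theorem dense_lowerSpectrumMap_unitInterval_le_zero (θ : Set.Ioo (0 : ℝ) 1) :
    Dense {F : NonemptyCompacts unitInterval | lowerSpectrumMap unitInterval (F, θ) ≤ 0} :=
  NonemptyCompacts.dense_setOfPred_finite.mono fun F hF =>
    lowerSpectrum_le_zero_of_finite hF F.nonempty θ.2

theorem dense_one_le_lowerSpectrumMap_unitInterval (θ : Set.Ioo (0 : ℝ) 1) :
    Dense {F : NonemptyCompacts unitInterval | 1 ≤ lowerSpectrumMap unitInterval (F, θ)} :=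
  dense_one_le_lowerSpectrum θ

/-- Composing the lower spectrum on `[0, 1]` with a map that separates values at most `0` from
finite values at least `1` does not give a function of Baire class one. -/
theorem not_isBaireClass_one_comp_lowerSpectrumMap_unitInterval {B : Type*} [TopologicalSpace B]
    [LinearOrder B] [OrderTopology B] {φ : EReal → B} {c d : B} (hcd : c < d)
    (hc : ∀ y ≤ 0, φ y < c) (hd : ∀ y, 1 ≤ y → y ≠ ⊤ → d < φ y) :
    ¬ IsBaireClass 1 fun p => φ (lowerSpectrumMap unitInterval p) := by
  intro h
  have hθ : (1 / 2 : ℝ) ∈ Set.Ioo (0 : ℝ) 1 := by norm_num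
  -- Any single slice suffices, as both dense families exist for every `θ`.
  generalize (⟨1 / 2, hθ⟩ : Set.Ioo (0 : ℝ) 1) = θ
  have hcont : Continuous fun F : NonemptyCompacts unitInterval => (F, θ) := by fun_prop
  exact not_isBaireClass_one_of_dense hcd
    ((dense_lowerSpectrumMap_unitInterval_le_zero θ).mono fun F hF => hc _ hF)
    ((dense_one_le_lowerSpectrumMap_unitInterval θ).mono fun F hF =>
      hd _ hF (lowerSpectrumMap_unitInterval_ne_top _))
    (h.comp_continuous hcont)

theorem not_isBaireClass_one_lowerSpectrumMap_unitInterval :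
    ¬ IsBaireClass 1 (lowerSpectrumMap unitInterval) :=
  not_isBaireClass_one_comp_lowerSpectrumMap_unitInterval (φ := fun y => y)
    (c := ((1 / 3 : ℝ) : EReal)) (d := ((2 / 3 : ℝ) : EReal))
    (EReal.coe_lt_coe_iff.2 (by norm_num))
    (fun _ hy => hy.trans_lt (EReal.coe_pos.2 (by norm_num)))
    (fun _ hy _ => lt_of_lt_of_le (EReal.coe_lt_coe_iff.2 (by norm_num : (2 / 3 : ℝ) < 1)) hy)

theorem not_isBaireClass_one_toReal_lowerSpectrumMap_unitInterval :
    ¬ IsBaireClass 1 fun p => (lowerSpectrumMap unitInterval p).toReal := by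
  refine not_isBaireClass_one_comp_lowerSpectrumMap_unitInterval (φ := EReal.toReal)
    (c := 1 / 3) (d := 2 / 3) (by norm_num) (fun y hy => ?_) fun y hy hy' => ?_
  · exact (EReal.toReal_nonpos hy).trans_lt (by norm_num)
  · have h1 := EReal.toReal_le_toReal hy (EReal.coe_ne_bot 1) hy'
    rw [EReal.toReal_one] at h1
    exact lt_of_lt_of_le (by norm_num) h1

end UnitInterval

theorem theorem5p2 :
    (∀ (X : Type*) [MetricSpace X] [CompactSpace X] [Nonempty X],
      IsBaireClass 2 (lowerSpectrumMap X) ∧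
      @Measurable _ _ (borel (NonemptyCompacts X × Set.Ioo (0 : ℝ) 1)) (borel EReal)
        (lowerSpectrumMap X) ∧
      ((∀ p, lowerSpectrumMap X p ≠ ⊤) →
        IsBaireClass 2 (fun p => (lowerSpectrumMap X p).toReal))) ∧
    ((∀ p, lowerSpectrumMap unitInterval p ≠ ⊤) ∧
      ¬ IsBaireClass 1 (lowerSpectrumMap unitInterval) ∧
      ¬ IsBaireClass 1 (fun p => (lowerSpectrumMap unitInterval p).toReal)) := by
  refine ⟨fun X _ _ _ => ⟨isBaireClass_two_lowerSpectrumMap, ?_,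
    isBaireClass_two_toReal_lowerSpectrumMap⟩, lowerSpectrumMap_unitInterval_ne_top,
    not_isBaireClass_one_lowerSpectrumMap_unitInterval,
    not_isBaireClass_one_toReal_lowerSpectrumMap_unitInterval⟩
  borelize (NonemptyCompacts X × Set.Ioo (0 : ℝ) 1)
  exact isBaireClass_two_lowerSpectrumMap.measurable
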